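/- All digraphs are finite and simple (no loops, no multiple arcs), and are considered up to isomorphism. The size of a digraph is its number of arcs, its order is its number of vertices. For a digraph $G$ let $A(G)$ be its adjacency matrix, $D(G)$ the diagonal matrix of its outdegrees, and, for $0\le\alpha<1$, let $A_\alpha(G)=\alpha D(G)+(1-\alpha)A(G)$; the $\alpha$-spectral radius $\rho_\alpha(G)$ is the largest modulus of an eigenvalue of $A_\alpha(G)$, and the signless Laplacian spectral radius of $G$ is the largest modulus of an eigenvalue of $D(G)+A(G)$. Let $\overrightarrow{C}_n$ $(n\ge 2)$ denote the directed cycle of length $n$. For $q\ge 2$, $2\le p\le s$ and two distinct vertices $u,v$ of $\overrightarrow{C}_q$, let $\mathrm{Inf}_{u,v}(p,q,s)$ be the digraph obtained from $\overrightarrow{C}_q$ by identifying $u$ with a vertex of a directed cycle $\overrightarrow{C}_p$ and $v$ with a vertex of a directed cycle $\overrightarrow{C}_s$ (the three cycles being otherwise disjoint). These digraphs are called tri-ring digraphs; for $q=2$ the digraph does not depend, up to isomorphism, on the choice of $u,v$ and is written $\mathrm{Inf}(p,2,s)$. **Theorem.** Let $m\ge 6$. Then $\mathrm{Inf}(2,2,m-4)$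 is a tri-ring digraph of size $m$ and order $m-2$, and the following hold. (i) For every $\alpha\in[0,1)$, every tri-ring digraph $G$ of size $m$ satisfies $\rho_\alpha(G)\le\rho_\alpha(\mathrm{Inf}(2,2,m-4))$, with equality only if $G$ is isomorphic to $\mathrm{Inf}(2,2,m-4)$; that is, $\mathrm{Inf}(2,2,m-4)$ is the unique digraph with maximal $\alpha$-spectral radius among all tri-ring digraphs of size $m$. (ii) $\mathrm{Inf}(2,2,m-4)$ is, up to isomorphism, the unique digraph with maximal signless Laplacian spectral radius among all tri-ring digraphs of size $m$, and likewise among all tri-ring digraphs of order $m-2$. -/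

import Mathlib

universe u

namespace AlphaSpectral

section Spectral

variable {V : Type*}

/-- The size of a digraph: its number of arcs. -/
noncomputable def size (G : Digraph V) : ℕ :=
  {e : V × V | G.Adj e.1 e.2}.ncard

/-- The outdegree of a vertex. -/
noncomputable def outDegree (G : Digraph V) (v : V) : ℕ :=
  {w : V | G.Adj v w}.ncard

open Classical in
/-- The adjacency matrix `A(G)`. -/
noncomputable def adjMatrix (G : Digraph V) : Matrix V V ℝ :=
  Matrix.of fun v w => if G.Adj v w then 1 else 0

open Classical in
/-- The diagonal matrix `D(G)` of outdegrees. -/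
noncomputable def outDegMatrix (G : Digraph V) : Matrix V V ℝ :=
  Matrix.diagonal fun v => (outDegree G v : ℝ)

/-- `A_α(G) = α D(G) + (1 - α) A(G)`. -/
noncomputable def alphaMatrix (α : ℝ) (G : Digraph V) : Matrix V V ℝ :=
  α • outDegMatrix G + (1 - α) • adjMatrix G

/-- The signless Laplacian matrix `D(G) + A(G)`. -/
noncomputable def signlessLaplacian (G : Digraph V) : Matrix V V ℝ :=
  outDegMatrix G + adjMatrix G

open Classical in
/-- The spectral radius of a real square matrix: the largest modulus of its complex eigenvalues. -/
noncomputable def matrixSpectralRadius [Fintype V] (M : Matrix V V ℝ) : ENNReal :=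
  spectralRadius ℂ (M.map (fun x : ℝ => (x : ℂ)))

/-- The `α`-spectral radius `ρ_α(G)`. -/
noncomputable def alphaRadius [Fintype V] (α : ℝ) (G : Digraph V) : ENNReal :=
  matrixSpectralRadius (alphaMatrix α G)

/-- The signless Laplacian spectral radius. -/
noncomputable def signlessRadius [Fintype V] (G : Digraph V) : ENNReal :=
  matrixSpectralRadius (signlessLaplacian G)

end Spectral

/-- Isomorphism of digraphs. -/
def Isomorphic {V W : Type*} (G : Digraph V) (H : Digraph W) : Prop :=
  Nonempty (G.Adj ≃r H.Adj)

/-- The directed cycle `0 → 1 → ⋯ → n - 1 → 0`. -/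
def dicycle (n : ℕ) : Digraph (Fin n) where
  Adj i j := j.val = (i.val + 1) % n

section Coalescence

variable {V W : Type*} [DecidableEq W]

/-- The vertex set of the coalescence of two digraphs on `V` and `W`, in which `w₀ : W` has been
identified with a vertex of `V`. -/
abbrev CoalVertex (V : Type*) {W : Type*} (w₀ : W) : Type _ := V ⊕ {w : W // w ≠ w₀}

/-- The map from `W` to the vertices of the coalescence; it sends `w₀` to `v₀`. -/
def coalMap (v₀ : V) (w₀ : W) (w : W) : CoalVertex V w₀ :=
  if h : w = w₀ then Sum.inl v₀ else Sum.inr ⟨w, h⟩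

/-- The coalescence of `G` and `H` obtained by identifying the vertex `v₀` of `G` with the
vertex `w₀` of `H`: its arcs are the images of the arcs of `G` and of the arcs of `H`. -/
def coalescence (G : Digraph V) (v₀ : V) (H : Digraph W) (w₀ : W) :
    Digraph (CoalVertex V w₀) where
  Adj x y :=
    (∃ a b : V, G.Adj a b ∧ Sum.inl a = x ∧ Sum.inl b = y) ∨
    (∃ a b : W, H.Adj a b ∧ coalMap v₀ w₀ a = x ∧ coalMap v₀ w₀ b = y)

end Coalescence

/-- The digraph `Inf_{u,v}(p, q, s)`: from the directed cycle of length `q`, identify its vertex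
`u` with the vertex `a` of a directed cycle of length `p`, and its vertex `v` with the vertex `b`
of a directed cycle of length `s`. -/
def triRing (p q s : ℕ) (u v : Fin q) (a : Fin p) (b : Fin s) :
    Digraph (CoalVertex (CoalVertex (Fin q) a) b) :=
  coalescence (coalescence (dicycle q) u (dicycle p) a) (Sum.inl v) (dicycle s) b

/-- A tri-ring digraph: a digraph isomorphic to some `Inf_{u,v}(p, q, s)` with `u ≠ v`
and `2 ≤ p ≤ s` (`u ≠ v` forces `2 ≤ q`). -/
def IsTriRing {V : Type*} (G : Digraph V) : Prop :=
  ∃ (p q s : ℕ) (u v : Fin q) (a : Fin p) (b : Fin s),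
    2 ≤ p ∧ p ≤ s ∧ u ≠ v ∧ Isomorphic G (triRing p q s u v a b)

/-- The digraph `Inf(2, 2, s)`. -/
def infTwoTwo (s : ℕ) (hs : 0 < s) :
    Digraph (CoalVertex (CoalVertex (Fin 2) (0 : Fin 2)) (⟨0, hs⟩ : Fin s)) :=
  triRing 2 2 s 0 1 0 ⟨0, hs⟩

end AlphaSpectral

/-!
Both families of matrices have the form `c D(G) + d A(G)` with `0 ≤ c` and `0 < d`. A nonnegative
matrix with a positive eigenvector has the corresponding eigenvalue as its spectral radius
(`matrixSpectralRadius_eq_of_pos_eigenvector`), so it suffices to exhibit such a vector for every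
tri-ring digraph.

Write the eigenvalue as `c + d t`, and put `β = c / d` and `z = 1 / t`. At a vertex of outdegree
one the eigenvalue equation says that the eigenvector is multiplied by `t` when passing to the
successor. Hence the vector is determined by its values `x`, `y` at the two vertices `u`, `v` of
outdegree two, where the remaining equations are
`(t - β - z ^ (p - 1)) x = z ^ (d(u, v) - 1) y` and
`(t - β - z ^ (s - 1)) y = z ^ (d(v, u) - 1) x`.
As `d(u, v) + d(v, u) = q`, they have a positive solution exactly if both factors are positive and
`(t - β - z ^ (p - 1)) (t - β - z ^ (s - 1)) = z ^ (q - 2)`. The intermediate value theorem gives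
such a `t > 1` (`exists_isPerronRoot_gt`), and `IsPerronRoot.radius_eq` computes the radius as
`c + d t`; it does not depend on the positions of `u` and `v`.

At a root for `(p, q, s)` with `p + q + s = m` the product for `(2, 2, m - 4)` is less than `1`
unless `p = q = 2` (`IsPerronRoot.extremal_lt`), so the intermediate value theorem, started at that
root, gives a strictly larger root for `(2, 2, m - 4)`. In the case `p = q = 2` the rotations of
the three cycles give an isomorphism (`isomorphic_infTwoTwo`). Finally the size of a tri-ring
digraph exceeds its order by two, so fixing the order amounts to fixing the size.
-/

namespace AlphaSpectral

open Finset

/-! ### Nonnegative matrices with a positive eigenvector -/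

section Radius

variable {V : Type*} [Fintype V]

/-- The easy half of the Perron–Frobenius theorem: if `μ` is a complex eigenvalue with eigenvector
`y`, then the eigenvalue equation at a vertex maximizing `‖y v‖ / x v` forces `‖μ‖ ≤ r`. -/
theorem matrixSpectralRadius_eq_of_pos_eigenvector [Nonempty V] {M : Matrix V V ℝ}
    (hM : ∀ v w, 0 ≤ M v w) {x : V → ℝ} (hx : ∀ v, 0 < x v) {r : ℝ} (hr : 0 ≤ r)
    (h : ∀ v, ∑ w, M v w * x w = r * x v) :
    matrixSpectralRadius M = ENNReal.ofReal r := by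
  classical
  have hspec : ∀ μ : ℂ, μ ∈ spectrum ℂ (M.map (fun x : ℝ => (x : ℂ))) ↔
      ∃ y : V → ℂ, y ≠ 0 ∧ ∀ v, ∑ w, (M v w : ℂ) * y w = μ * y v := by
    intro μ
    rw [← Matrix.spectrum_toLin', ← Module.End.hasEigenvalue_iff_mem_spectrum]
    constructor
    · intro hμ
      obtain ⟨y, hy⟩ := hμ.exists_hasEigenvector
      refine ⟨y, hy.2, fun v => ?_⟩
      have := congrFun hy.apply_eq_smul v
      simpa [Matrix.mulVec, dotProduct] using this
    · rintro ⟨y, hy0, hy⟩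
      refine Module.End.hasEigenvalue_of_hasEigenvector (x := y)
        ⟨Module.End.mem_eigenspace_iff.2 ?_, hy0⟩
      ext v
      simpa [Matrix.mulVec, dotProduct] using hy v
  unfold matrixSpectralRadius spectralRadius
  apply le_antisymm
  · refine iSup₂_le fun μ hμ => ?_
    obtain ⟨y, hy0, hy⟩ := (hspec μ).1 (by convert hμ)
    obtain ⟨v, -, hv⟩ := exists_max_image univ (fun v => ‖y v‖ / x v) univ_nonempty
    have hle : ∀ w, ‖y w‖ ≤ ‖y v‖ / x v * x w := fun w =>
      (div_le_iff₀ (hx w)).1 (hv w (mem_univ w))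
    have hyv : 0 < ‖y v‖ := by
      by_contra hcon
      apply hy0
      ext w
      have h0 : ‖y v‖ = 0 := le_antisymm (not_lt.1 hcon) (norm_nonneg _)
      have := hle w
      rw [h0] at this
      simpa using this
    have key : ‖μ‖ * ‖y v‖ ≤ r * ‖y v‖ := by
      calc ‖μ‖ * ‖y v‖ = ‖∑ w, (M v w : ℂ) * y w‖ := by rw [hy v, norm_mul]
        _ ≤ ∑ w, M v w * (‖y v‖ / x v * x w) := by
            refine (norm_sum_le _ _).trans (sum_le_sum fun w _ => ?_)
            rw [norm_mul, Complex.norm_real, Real.norm_of_nonneg (hM v w)]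
            exact mul_le_mul_of_nonneg_left (hle w) (hM v w)
        _ = ‖y v‖ / x v * ∑ w, M v w * x w := by
            rw [mul_sum]; exact sum_congr rfl fun w _ => by ring
        _ = r * ‖y v‖ := by
            rw [h v]; field_simp [(hx v).ne']
    have hμr : ‖μ‖ ≤ r := le_of_mul_le_mul_right key hyv
    change ‖μ‖ₑ ≤ ENNReal.ofReal r
    rw [← ofReal_norm]
    exact ENNReal.ofReal_le_ofReal hμr
  · have hmem : (r : ℂ) ∈ spectrum ℂ (M.map (fun x : ℝ => (x : ℂ))) := by
      refine (hspec r).2 ⟨fun v => (x v : ℂ), fun h0 => ?_, fun v => ?_⟩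
      · obtain ⟨v⟩ := ‹Nonempty V›
        have := congrFun h0 v
        simp only [Pi.zero_apply, Complex.ofReal_eq_zero] at this
        exact (hx v).ne' this
      · have := congrArg (fun a : ℝ => (a : ℂ)) (h v)
        push_cast at this
        exact this
    refine le_trans ?_ (le_iSup₂ (f := fun (k : ℂ) (_ : k ∈ spectrum ℂ _) => (‖k‖₊ : ENNReal))
      (r : ℂ) (by convert hmem))
    rw [show (‖(r : ℂ)‖₊ : ENNReal) = ENNReal.ofReal ‖(r : ℂ)‖ from
      (ofReal_norm _).symm, Complex.norm_real, Real.norm_of_nonneg hr]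

/-- The spectral radius of the matrix `c D(G) + d A(G)`. -/
noncomputable def degAdjRadius (c d : ℝ) (G : Digraph V) : ENNReal :=
  matrixSpectralRadius (c • outDegMatrix G + d • adjMatrix G)

theorem alphaRadius_eq_degAdjRadius (α : ℝ) (G : Digraph V) :
    alphaRadius α G = degAdjRadius α (1 - α) G := rfl

theorem signlessRadius_eq_degAdjRadius (G : Digraph V) :
    signlessRadius G = degAdjRadius 1 1 G := by
  rw [signlessRadius, degAdjRadius, one_smul, one_smul, signlessLaplacian]

end Radius

/-! ### Sums over out-neighbourhoods -/

section ArcSum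

variable {V W : Type*} [Fintype V] [Fintype W]

open Classical in
/-- The sum of `c` over the out-neighbours of `v`: the entry at `v` of `A(G) c`, and the outdegree
of `v` if `c` is constantly `1`. -/
noncomputable def arcSum (G : Digraph V) (c : V → ℝ) (v : V) : ℝ :=
  ∑ w, if G.Adj v w then c w else 0

theorem outDegree_eq_arcSum (G : Digraph V) (v : V) :
    (outDegree G v : ℝ) = arcSum G (fun _ => 1) v := by
  classical
  simp [outDegree, arcSum, Set.ncard_eq_toFinset_card']

theorem size_eq_sum_arcSum (G : Digraph V) :
    (size G : ℝ) = ∑ v, arcSum G (fun _ => 1) v := by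
  classical
  simp only [arcSum]
  rw [← Fintype.sum_prod_type' (f := fun v w => if G.Adj v w then (1 : ℝ) else 0)]
  simp [size, Set.ncard_eq_toFinset_card']

theorem arcSum_of_iso {G : Digraph V} {H : Digraph W} (e : G.Adj ≃r H.Adj) (c : W → ℝ) (v : V) :
    arcSum G (fun w => c (e w)) v = arcSum H c (e v) := by
  classical
  unfold arcSum
  refine Fintype.sum_equiv e.toEquiv _ _ fun w => ?_
  have := e.map_rel_iff (a := v) (b := w)
  simp [this]

theorem size_eq_of_iso {G : Digraph V} {H : Digraph W} (e : G.Adj ≃r H.Adj) :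
    size G = size H := by
  have : (size G : ℝ) = size H := by
    rw [size_eq_sum_arcSum, size_eq_sum_arcSum]
    exact Fintype.sum_equiv e.toEquiv _ _ fun v => arcSum_of_iso e (fun _ => 1) v
  exact_mod_cast this

/-- The eigenvalue equation of `a D(G) + b A(G)` written with sums over out-neighbourhoods. -/
theorem degAdjRadius_eq_of_pos_eigenvector [Nonempty V] (G : Digraph V) {a b r : ℝ} (ha : 0 ≤ a)
    (hb : 0 ≤ b) (hr : 0 ≤ r) {x : V → ℝ} (hx : ∀ v, 0 < x v)
    (h : ∀ v, a * (arcSum G (fun _ => 1) v * x v) + b * arcSum G x v = r * x v) :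
    degAdjRadius a b G = ENNReal.ofReal r := by
  classical
  unfold degAdjRadius
  apply matrixSpectralRadius_eq_of_pos_eigenvector _ hx hr
  · intro v
    rw [← h v, ← outDegree_eq_arcSum]
    simp only [Matrix.add_apply, Matrix.smul_apply, smul_eq_mul, add_mul, sum_add_distrib,
      outDegMatrix, adjMatrix, Matrix.of_apply, Matrix.diagonal_apply, arcSum, mul_sum]
    congr 1
    · rw [sum_eq_single v]
      · simp [mul_assoc]
      · intro w _ hw
        simp [hw.symm]
      · simp
    · refine sum_congr rfl fun w _ => ?_
      split_ifs <;> simp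
  · intro v w
    simp only [Matrix.add_apply, Matrix.smul_apply, smul_eq_mul, outDegMatrix, adjMatrix,
      Matrix.of_apply, Matrix.diagonal_apply]
    split_ifs <;> positivity

end ArcSum

/-! ### Coalescences -/

section Coal

variable {V W : Type*} [DecidableEq W] {G : Digraph V} {H : Digraph W} {v₀ : V} {w₀ : W}

@[simp] theorem coalMap_self : coalMap v₀ w₀ w₀ = Sum.inl v₀ := by simp [coalMap]

theorem coalMap_of_ne {w : W} (h : w ≠ w₀) : coalMap v₀ w₀ w = Sum.inr ⟨w, h⟩ := by
  simp [coalMap, h]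

theorem coalMap_eq_inl {w : W} {a : V} :
    coalMap v₀ w₀ w = Sum.inl a ↔ w = w₀ ∧ v₀ = a := by
  unfold coalMap; split_ifs with h <;> simp [h]

theorem coalMap_eq_inr {w : W} {w' : {w : W // w ≠ w₀}} :
    coalMap v₀ w₀ w = Sum.inr w' ↔ w = w' := by
  unfold coalMap
  split_ifs with h
  · simpa [h] using w'.2.symm
  · simp [Subtype.ext_iff]

theorem coalescence_inl_inl (hH : ¬ H.Adj w₀ w₀) {a b : V} :
    (coalescence G v₀ H w₀).Adj (Sum.inl a) (Sum.inl b) ↔ G.Adj a b := by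
  simp only [coalescence, Sum.inl.injEq, coalMap_eq_inl]
  constructor
  · rintro (⟨_, _, h, rfl, rfl⟩ | ⟨_, _, h, ⟨rfl, _⟩, ⟨rfl, _⟩⟩)
    · exact h
    · exact absurd h hH
  · exact fun h => Or.inl ⟨a, b, h, rfl, rfl⟩

theorem coalescence_inl_inr {a : V} {w : {w : W // w ≠ w₀}} :
    (coalescence G v₀ H w₀).Adj (Sum.inl a) (Sum.inr w) ↔ a = v₀ ∧ H.Adj w₀ w := by
  simp only [coalescence, coalMap_eq_inl, coalMap_eq_inr]
  constructor
  · rintro (⟨_, _, h, _, h'⟩ | ⟨_, _, h, ⟨rfl, rfl⟩, rfl⟩)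
    · cases h'
    · exact ⟨rfl, h⟩
  · rintro ⟨rfl, h⟩
    exact Or.inr ⟨w₀, w, h, ⟨rfl, rfl⟩, rfl⟩

theorem coalescence_inr_inl {a : V} {w : {w : W // w ≠ w₀}} :
    (coalescence G v₀ H w₀).Adj (Sum.inr w) (Sum.inl a) ↔ a = v₀ ∧ H.Adj w w₀ := by
  simp only [coalescence, coalMap_eq_inl, coalMap_eq_inr]
  constructor
  · rintro (⟨_, _, h, h', _⟩ | ⟨_, _, h, rfl, ⟨rfl, rfl⟩⟩)
    · cases h'
    · exact ⟨rfl, h⟩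
  · rintro ⟨rfl, h⟩
    exact Or.inr ⟨w, w₀, h, rfl, ⟨rfl, rfl⟩⟩

theorem coalescence_inr_inr {w w' : {w : W // w ≠ w₀}} :
    (coalescence G v₀ H w₀).Adj (Sum.inr w) (Sum.inr w') ↔ H.Adj w w' := by
  simp only [coalescence, coalMap_eq_inr]
  constructor
  · rintro (⟨_, _, h, h', _⟩ | ⟨_, _, h, rfl, rfl⟩)
    · cases h'
    · exact h
  · exact fun h => Or.inr ⟨w, w', h, rfl, rfl⟩

variable [Fintype V] [Fintype W]

theorem sum_eq_add_sum_ne (f : W → ℝ) (w₀ : W) :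
    ∑ w, f w = f w₀ + ∑ w : {w : W // w ≠ w₀}, f w :=
  Fintype.sum_eq_add_sum_subtype_ne f w₀

/-! A loop at `w₀` would be mapped to a loop at `v₀`, which `G` may already have; without it the arcs
of `G` and of `H` stay distinct in the coalescence. -/

theorem arcSum_coalescence_inl_of_ne (hH : ¬ H.Adj w₀ w₀) (c : CoalVertex V w₀ → ℝ) {a : V}
    (ha : a ≠ v₀) :
    arcSum (coalescence G v₀ H w₀) c (Sum.inl a) = arcSum G (fun v => c (Sum.inl v)) a := by
  classical
  simp [arcSum, Fintype.sum_sum_type, coalescence_inl_inl hH, coalescence_inl_inr, ha]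

theorem arcSum_coalescence_inl (hH : ¬ H.Adj w₀ w₀) (c : CoalVertex V w₀ → ℝ) :
    arcSum (coalescence G v₀ H w₀) c (Sum.inl v₀) =
      arcSum G (fun v => c (Sum.inl v)) v₀ + arcSum H (fun w => c (coalMap v₀ w₀ w)) w₀ := by
  classical
  simp only [arcSum, Fintype.sum_sum_type, coalescence_inl_inl hH, coalescence_inl_inr, true_and]
  rw [sum_eq_add_sum_ne _ w₀, if_neg hH, zero_add]
  congr 1
  exact sum_congr rfl fun w _ => by rw [coalMap_of_ne w.2]

theorem arcSum_coalescence_inr (c : CoalVertex V w₀ → ℝ) (w : {w : W // w ≠ w₀}) :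
    arcSum (coalescence G v₀ H w₀) c (Sum.inr w) =
      arcSum H (fun w => c (coalMap v₀ w₀ w)) w := by
  classical
  simp only [arcSum, Fintype.sum_sum_type, coalescence_inr_inl, coalescence_inr_inr]
  rw [sum_eq_add_sum_ne _ w₀, coalMap_self]
  congr 1
  · rw [sum_eq_single v₀]
    · simp
    · intro a _ ha
      simp [ha]
    · simp
  · exact sum_congr rfl fun w _ => by rw [coalMap_of_ne w.2]

theorem size_coalescence (hH : ¬ H.Adj w₀ w₀) :
    size (coalescence G v₀ H w₀) = size G + size H := by
  classical
  have : (size (coalescence G v₀ H w₀) : ℝ) = size G + size H := by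
    rw [size_eq_sum_arcSum, size_eq_sum_arcSum G, size_eq_sum_arcSum H, Fintype.sum_sum_type,
      sum_eq_add_sum_ne _ w₀, ← add_assoc]
    congr 1
    · have : ∀ a, arcSum (coalescence G v₀ H w₀) (fun _ => 1) (Sum.inl a) =
          arcSum G (fun _ => 1) a + if a = v₀ then arcSum H (fun _ => 1) w₀ else 0 := by
        intro a
        split_ifs with ha
        · rw [ha, arcSum_coalescence_inl hH]
        · rw [arcSum_coalescence_inl_of_ne hH _ ha, add_zero]
      simp only [this, sum_add_distrib]
      simp
    · exact sum_congr rfl fun w _ => arcSum_coalescence_inr _ w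
  exact_mod_cast this

theorem card_coalVertex (V : Type*) {W : Type*} [Fintype V] [Fintype W] [DecidableEq W] (w₀ : W) :
    Fintype.card (CoalVertex V w₀) = Fintype.card V + (Fintype.card W - 1) := by
  rw [Fintype.card_sum]
  congr 1
  exact Set.card_ne_eq w₀

end Coal

/-- Coalescence is functorial for isomorphisms that match the identified vertices. -/
theorem isomorphic_coalescence {V V' W W' : Type*} [DecidableEq W] [DecidableEq W']
    {G : Digraph V} {G' : Digraph V'} {H : Digraph W} {H' : Digraph W'}
    {v₀ : V} {w₀ : W} {v₀' : V'} {w₀' : W'} (e : G.Adj ≃r G'.Adj) (f : H.Adj ≃r H'.Adj)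
    (he : e v₀ = v₀') (hf : f w₀ = w₀') (hH : ¬ H.Adj w₀ w₀) :
    ∃ g : (coalescence G v₀ H w₀).Adj ≃r (coalescence G' v₀' H' w₀').Adj,
      ∀ v, g (Sum.inl v) = Sum.inl (e v) := by
  subst he hf
  have hH' : ¬ H'.Adj (f w₀) (f w₀) := fun h => hH (f.map_rel_iff.1 h)
  refine ⟨⟨Equiv.sumCongr e.toEquiv (f.toEquiv.subtypeEquiv fun w => by simp), ?_⟩, fun v => rfl⟩
  rintro (a | w) (b | w')
  · simpa [coalescence_inl_inl hH, coalescence_inl_inl hH'] using e.map_rel_iff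
  · simpa [coalescence_inl_inr] using fun _ => f.map_rel_iff
  · simpa [coalescence_inr_inl] using fun _ => f.map_rel_iff
  · simpa [coalescence_inr_inr] using f.map_rel_iff

/-! ### Directed cycles -/

section Cycle

variable {n : ℕ}

/-- The successor of `i` on the directed cycle. -/
def cycSucc (i : Fin n) : Fin n := ⟨(i.val + 1) % n, Nat.mod_lt _ i.pos⟩

/-- The distance from `i` to `j` along the directed cycle; it is `0` for `i = j`. -/
def cycDist (i j : Fin n) : ℕ := if i.val ≤ j.val then j.val - i.val else j.val + n - i.val

theorem cycSucc_val (i : Fin n) :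
    (cycSucc i).val = if i.val + 1 = n then 0 else i.val + 1 := by
  have := i.2
  unfold cycSucc
  split_ifs with h
  · simp [h]
  · exact Nat.mod_eq_of_lt (by omega)

theorem dicycle_adj {i j : Fin n} : (dicycle n).Adj i j ↔ j = cycSucc i := by
  simp [dicycle, cycSucc, Fin.ext_iff]

theorem dicycle_no_loop (hn : 2 ≤ n) (i : Fin n) : ¬ (dicycle n).Adj i i := by
  rw [dicycle_adj, Fin.ext_iff, cycSucc_val]
  split_ifs <;> omega

theorem arcSum_dicycle (c : Fin n → ℝ) (i : Fin n) :
    arcSum (dicycle n) c i = c (cycSucc i) := by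
  simp [arcSum, dicycle_adj]

theorem size_dicycle (n : ℕ) : size (dicycle n) = n := by
  have : (size (dicycle n) : ℝ) = n := by
    rw [size_eq_sum_arcSum]; simp [arcSum_dicycle]
  exact_mod_cast this

@[simp] theorem cycDist_self (i : Fin n) : cycDist i i = 0 := by simp [cycDist]

theorem cycDist_pos {i j : Fin n} (h : i ≠ j) : 0 < cycDist i j := by
  have := i.2
  rw [Ne, Fin.ext_iff] at h
  unfold cycDist; split_ifs <;> omega

theorem cycDist_succ {i j : Fin n} (h : i ≠ j) : cycDist i j = cycDist (cycSucc i) j + 1 := by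
  have := i.2
  have := j.2
  rw [Ne, Fin.ext_iff] at h
  unfold cycDist; rw [cycSucc_val]; split_ifs <;> omega

theorem cycDist_succ_self (i : Fin n) : cycDist (cycSucc i) i = n - 1 := by
  have := i.2
  unfold cycDist; rw [cycSucc_val]; split_ifs <;> omega

theorem cycDist_add {i j : Fin n} (h : i ≠ j) : cycDist i j + cycDist j i = n := by
  have := i.2
  have := j.2
  rw [Ne, Fin.ext_iff] at h
  unfold cycDist; split_ifs <;> omega

/-- Rotations show that the directed cycle is vertex-transitive. -/
theorem exists_dicycle_iso (a b : Fin n) :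
    ∃ e : (dicycle n).Adj ≃r (dicycle n).Adj, e a = b := by
  have : NeZero n := ⟨a.pos.ne'⟩
  have hs : ∀ i : Fin n, cycSucc i = i + 1 := by
    intro i
    ext
    rw [Fin.val_add, cycSucc, Fin.val_one', Nat.add_mod_mod]
  refine ⟨⟨Equiv.addRight (b - a), ?_⟩, ?_⟩
  · intro i j
    rw [dicycle_adj, dicycle_adj, hs, hs]
    simp only [Equiv.coe_addRight]
    rw [show i + (b - a) + 1 = i + 1 + (b - a) by abel, add_left_inj]
  · simp

end Cycle

/-! ### The characteristic equation -/

/-- The number `t` satisfies the characteristic equation of the tri-ring digraphs with cycle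
lengths `p`, `q`, `s`, with a sign condition that makes the corresponding eigenvector positive. -/
structure IsPerronRoot (β : ℝ) (p q s : ℕ) (t : ℝ) : Prop where
  one_lt : 1 < t
  pos_left : 0 < t - β - t⁻¹ ^ (p - 1)
  pos_right : 0 < t - β - t⁻¹ ^ (s - 1)
  eq : (t - β - t⁻¹ ^ (p - 1)) * (t - β - t⁻¹ ^ (s - 1)) = t⁻¹ ^ (q - 2)

/-- The left side of the characteristic equation tends to infinity, so a root exists beyond every
`t₀ ≥ 1` at which that side is too small or its first factor is not positive. -/
theorem exists_isPerronRoot_gt {β t₀ : ℝ} {p q s : ℕ} (hβ : 0 ≤ β) (ht₀ : 1 ≤ t₀) (hps : p ≤ s)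
    (h : t₀ - β - t₀⁻¹ ^ (p - 1) ≤ 0 ∨
      (t₀ - β - t₀⁻¹ ^ (p - 1)) * (t₀ - β - t₀⁻¹ ^ (s - 1)) < t₀⁻¹ ^ (q - 2)) :
    ∃ t, t₀ < t ∧ IsPerronRoot β p q s t := by
  -- Truncating the first factor at `0` discards the roots where both factors are negative.
  set f : ℝ → ℝ := fun t =>
    max (t - β - t⁻¹ ^ (p - 1)) 0 * (t - β - t⁻¹ ^ (s - 1)) - t⁻¹ ^ (q - 2) with hf
  have hpow1 : ∀ t : ℝ, 1 ≤ t → ∀ k : ℕ, t⁻¹ ^ k ≤ 1 := fun t ht k =>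
    pow_le_one₀ (by positivity) (inv_le_one_of_one_le₀ ht)
  have hpow0 : ∀ t : ℝ, 1 ≤ t → ∀ k : ℕ, 0 < t⁻¹ ^ k := fun t ht k =>
    pow_pos (inv_pos.2 (by linarith)) k
  have h0 : f t₀ < 0 := by
    simp only [hf]
    rcases le_or_gt (t₀ - β - t₀⁻¹ ^ (p - 1)) 0 with h1 | h1
    · rw [max_eq_right h1]
      linarith [hpow0 t₀ ht₀ (q - 2)]
    · rw [max_eq_left h1.le]
      rcases h with h | h <;> linarith
  set T := t₀ + β + 3 with hT
  have hT1 : 1 ≤ T := by linarith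
  have h1 : 0 ≤ f T := by
    simp only [hf]
    have a1 : 1 ≤ max (T - β - T⁻¹ ^ (p - 1)) 0 :=
      le_max_of_le_left (by linarith [hpow1 T hT1 (p - 1)])
    have a2 : 1 ≤ T - β - T⁻¹ ^ (s - 1) := by linarith [hpow1 T hT1 (s - 1)]
    have a3 := one_le_mul_of_one_le_of_one_le a1 a2
    linarith [hpow1 T hT1 (q - 2)]
  have hc : ContinuousOn f (Set.Icc t₀ T) := by
    have hinv : ContinuousOn (fun t : ℝ => t⁻¹) (Set.Icc t₀ T) :=
      continuousOn_inv₀.mono fun t ht => by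
        have : (0 : ℝ) < t := by linarith [ht.1]
        exact this.ne'
    have hφ : ∀ k : ℕ, ContinuousOn (fun t : ℝ => t - β - t⁻¹ ^ k) (Set.Icc t₀ T) := fun k =>
      (continuousOn_id.sub continuousOn_const).sub (hinv.pow k)
    exact (((hφ _).sup continuousOn_const).mul (hφ _)).sub (hinv.pow _)
  obtain ⟨t, ht, hft⟩ := intermediate_value_Icc (by linarith) hc ⟨h0.le, h1⟩
  have htt : t₀ < t := lt_of_le_of_ne ht.1 fun h => by rw [← h] at hft; linarith
  have ht1 : 1 < t := by linarith
  simp only [hf] at hft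
  have hq := hpow0 t ht1.le (q - 2)
  have hp : 0 < t - β - t⁻¹ ^ (p - 1) := by
    by_contra hcon
    rw [max_eq_right (not_lt.1 hcon)] at hft
    linarith
  rw [max_eq_left hp.le] at hft
  have hle : t⁻¹ ^ (s - 1) ≤ t⁻¹ ^ (p - 1) :=
    pow_le_pow_of_le_one (by positivity) (inv_le_one_of_one_le₀ ht1.le) (by omega)
  exact ⟨t, htt, ht1, hp, by linarith, by linarith⟩

theorem exists_isPerronRoot {β : ℝ} {p s : ℕ} (q : ℕ) (hβ : 0 ≤ β) (hps : p ≤ s) :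
    ∃ t, IsPerronRoot β p q s t := by
  obtain ⟨t, -, ht⟩ := exists_isPerronRoot_gt (p := p) (q := q) hβ le_rfl hps
    (Or.inl (by simpa using hβ))
  exact ⟨t, ht⟩

/-- At a root for `(p, q, s)` the characteristic equation of `(2, 2, m - 4)` fails in a definite
direction. With `z = 1 / t`, `X = t - β`, `A = z ^ (p - 2)`, `B = z ^ (s - p)` and
`K = z ^ (q - 2)`, the right side minus the left side is
`(1 - K) * (1 + z ^ 2 * A ^ 2 * B - X * z * A ^ 2 * B) + X * z * (1 - A) * (1 - A * B)`, and the
bound `X ≤ 1 + z` makes the second factor of the first product positive. -/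
theorem IsPerronRoot.extremal_lt {β t : ℝ} {p q s m : ℕ} (h : IsPerronRoot β p q s t)
    (hp : 2 ≤ p) (hps : p ≤ s) (hq : 2 ≤ q) (hm : p + q + s = m) (hne : ¬ (p = 2 ∧ q = 2)) :
    (t - β - t⁻¹ ^ (2 - 1)) * (t - β - t⁻¹ ^ (m - 4 - 1)) < t⁻¹ ^ (2 - 2) := by
  obtain ⟨i, rfl⟩ := Nat.exists_eq_add_of_le hp
  obtain ⟨j, rfl⟩ := Nat.exists_eq_add_of_le hps
  obtain ⟨k, rfl⟩ := Nat.exists_eq_add_of_le hq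
  obtain ⟨ht, h1, h2, h3⟩ := h
  have hz0 : 0 < t⁻¹ := inv_pos.2 (by linarith)
  have hz1 : t⁻¹ < 1 := inv_lt_one_of_one_lt₀ ht
  rw [show m - 4 - 1 = i + i + j + k + 1 by omega]
  rw [show 2 + i - 1 = i + 1 by omega] at h1 h3
  rw [show 2 + i + j - 1 = i + j + 1 by omega] at h2 h3
  rw [show 2 + k - 2 = k by omega] at h3
  generalize t⁻¹ = z at *
  generalize t - β = X at *
  simp only [pow_add, pow_one, Nat.sub_self, pow_zero, show 2 - 1 = 1 from rfl] at *
  have hpos : ∀ l : ℕ, 0 < z ^ l := fun l => pow_pos hz0 l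
  have hle : ∀ l : ℕ, z ^ l ≤ 1 := fun l => pow_le_one₀ hz0.le hz1.le
  have hlt : ∀ l : ℕ, l ≠ 0 → z ^ l < 1 := fun l hl => pow_lt_one₀ hz0.le hz1 hl
  have hAK : z ^ i < 1 ∨ z ^ k < 1 := by
    by_cases hi : i = 0
    · exact Or.inr (hlt k fun hk => hne ⟨by omega, by omega⟩)
    · exact Or.inl (hlt i hi)
  have hA0 := hpos i
  have hB0 := hpos j
  have hK0 := hpos k
  have hA1 := hle i
  have hB1 := hle j
  have hK1 := hle k
  generalize z ^ i = A at *
  generalize z ^ j = B at *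
  generalize z ^ k = K at *
  have hAB : A * B ≤ A := mul_le_of_le_one_right hA0.le hB1
  have hAB0 : 0 < A * B := mul_pos hA0 hB0
  have hX0 : 0 < X := by nlinarith
  have hX1 : X ≤ 1 + z := by
    by_contra hcon
    have e1 : 1 < X - A * z := by nlinarith
    have e2 : 1 < X - A * B * z := by nlinarith
    have := one_lt_mul_of_lt_of_le e1 e2.le
    linarith
  have hC0 : 0 < A * A * B := by positivity
  have hC1 : A * A * B ≤ 1 := by nlinarith
  have hfac : 0 < 1 + z * z * (A * A * B) - X * z * (A * A * B) := by
    have e1 : X * (z * (A * A * B)) ≤ (1 + z) * (z * (A * A * B)) :=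
      mul_le_mul_of_nonneg_right hX1 (by positivity)
    have e2 : z * (A * A * B) < 1 := by nlinarith
    nlinarith
  have key : 0 < (1 - K) * (1 + z * z * (A * A * B) - X * z * (A * A * B)) +
      X * z * ((1 - A) * (1 - A * B)) := by
    rcases hAK with hA | hK
    · have : 0 < X * z * ((1 - A) * (1 - A * B)) :=
        mul_pos (mul_pos hX0 hz0) (mul_pos (by linarith) (by linarith))
      have := mul_nonneg (sub_nonneg.2 hK1) hfac.le
      linarith
    · have : 0 ≤ X * z * ((1 - A) * (1 - A * B)) :=
        mul_nonneg (mul_pos hX0 hz0).le (mul_nonneg (by linarith) (by linarith))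
      have := mul_pos (sub_pos.2 hK) hfac
      linarith
  linarith

/-! ### The spectral radius of a tri-ring digraph -/

section TriRing

variable {p q s : ℕ}

/-- The value at `i` of the eigenvector on the cycle of length `q`, when it takes the values
`x` at `u` and `y` at `v`: going backwards from the next of these two vertices, it decays by a
factor `z` at each step. -/
noncomputable def ringVec (z : ℝ) (u v : Fin q) (x y : ℝ) (i : Fin q) : ℝ :=
  if cycDist i u ≤ cycDist i v then z ^ cycDist i u * x else z ^ cycDist i v * y

theorem ringVec_left (z : ℝ) (u v : Fin q) (x y : ℝ) : ringVec z u v x y u = x := by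
  simp [ringVec]

theorem ringVec_right (z : ℝ) {u v : Fin q} (h : u ≠ v) (x y : ℝ) :
    ringVec z u v x y v = y := by
  have := cycDist_pos h.symm
  simp [ringVec, this.ne']

theorem ringVec_eq {z : ℝ} {u v : Fin q} {x y : ℝ} {i : Fin q} (hu : i ≠ u) (hv : i ≠ v) :
    ringVec z u v x y i = z * ringVec z u v x y (cycSucc i) := by
  unfold ringVec
  rw [cycDist_succ hu, cycDist_succ hv]
  simp only [add_le_add_iff_right, pow_succ]
  split_ifs <;> ring

theorem ringVec_succ_left {z : ℝ} {u v : Fin q} {x y : ℝ} (h : u ≠ v) :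
    ringVec z u v x y (cycSucc u) = z ^ (cycDist u v - 1) * y := by
  have h1 := cycDist_succ h
  have h2 := cycDist_add h
  have h3 := cycDist_pos h.symm
  rw [ringVec, cycDist_succ_self, if_neg (by omega), h1, Nat.add_sub_cancel]

theorem ringVec_succ_right {z : ℝ} {u v : Fin q} {x y : ℝ} (h : u ≠ v) :
    ringVec z u v x y (cycSucc v) = z ^ (cycDist v u - 1) * x := by
  have h1 := cycDist_succ h.symm
  have h2 := cycDist_add h
  rw [ringVec, cycDist_succ_self, if_pos (by omega), h1, Nat.add_sub_cancel]

/-- The eigenvector of `Inf_{u,v}(p, q, s)` with values `x` at `u` and `y` at `v`. -/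
noncomputable def triVec (z : ℝ) (u v : Fin q) (a : Fin p) (b : Fin s) (x y : ℝ) :
    CoalVertex (CoalVertex (Fin q) a) b → ℝ
  | Sum.inl (Sum.inl i) => ringVec z u v x y i
  | Sum.inl (Sum.inr w) => z ^ cycDist w.1 a * x
  | Sum.inr w => z ^ cycDist w.1 b * y

theorem triVec_coalMap_left (z : ℝ) (u v : Fin q) (a : Fin p) (b : Fin s) (x y : ℝ) (w : Fin p) :
    triVec z u v a b x y (Sum.inl (coalMap u a w)) = z ^ cycDist w a * x := by
  by_cases h : w = a
  · subst h
    simp [triVec, ringVec_left]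
  · rw [coalMap_of_ne h]; rfl

theorem triVec_coalMap_right (z : ℝ) {u v : Fin q} (huv : u ≠ v) (a : Fin p) (b : Fin s) (x y : ℝ)
    (w : Fin s) :
    triVec z u v a b x y (coalMap (Sum.inl v) b w) = z ^ cycDist w b * y := by
  by_cases h : w = b
  · subst h
    simp [triVec, ringVec_right z huv]
  · rw [coalMap_of_ne h]; rfl

variable {u v : Fin q} {a : Fin p} {b : Fin s}

theorem size_triRing (hp : 2 ≤ p) (hs : 2 ≤ s) : size (triRing p q s u v a b) = p + q + s := by
  rw [triRing, size_coalescence (dicycle_no_loop hs b), size_coalescence (dicycle_no_loop hp a),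
    size_dicycle, size_dicycle, size_dicycle, add_comm q p]

theorem card_triRing (hp : 2 ≤ p) (hs : 2 ≤ s) :
    Fintype.card (CoalVertex (CoalVertex (Fin q) a) b) = p + q + s - 2 := by
  rw [card_coalVertex, card_coalVertex, Fintype.card_fin, Fintype.card_fin, Fintype.card_fin]
  omega

/-- The eigenvector equation at each vertex. At a vertex of outdegree one it holds for every
`t`, and at the two vertices of outdegree two it amounts to the characteristic equation, once the
values at `u` and `v` are chosen as `t⁻¹ ^ (d(u, v) - 1)` and `t - β - t⁻¹ ^ (p - 1)`. -/
theorem IsPerronRoot.triRing_eigen {β t c d : ℝ} (h : IsPerronRoot β p q s t) (hp : 2 ≤ p)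
    (hs : 2 ≤ s) (huv : u ≠ v) (hβ : c = d * β)
    (k : CoalVertex (CoalVertex (Fin q) a) b) :
    let X := triVec t⁻¹ u v a b (t⁻¹ ^ (cycDist u v - 1)) (t - β - t⁻¹ ^ (p - 1))
    c * (arcSum (triRing p q s u v a b) (fun _ => 1) k * X k) +
      d * arcSum (triRing p q s u v a b) X k = (c + d * t) * X k := by
  intro X
  have hb := dicycle_no_loop hs b
  have ha := dicycle_no_loop hp a
  have ht0 : t ≠ 0 := by linarith [h.one_lt]
  have hz : t * t⁻¹ = 1 := mul_inv_cancel₀ ht0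
  unfold triRing
  rcases k with (i | w) | w
  · by_cases hu : i = u
    · subst hu
      have hne : (Sum.inl i : CoalVertex (Fin q) a) ≠ Sum.inl v := by simpa using huv
      rw [arcSum_coalescence_inl_of_ne hb _ hne, arcSum_coalescence_inl_of_ne hb _ hne,
        arcSum_coalescence_inl ha, arcSum_coalescence_inl ha]
      simp only [arcSum_dicycle]
      simp only [X, triVec_coalMap_left, cycDist_succ_self]
      simp only [triVec, ringVec_left, ringVec_succ_left huv, hβ]
      ring
    by_cases hv : i = v
    · subst hv
      have hui : i ≠ u := hu
      rw [arcSum_coalescence_inl hb, arcSum_coalescence_inl hb,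
        arcSum_coalescence_inl_of_ne ha _ hui, arcSum_coalescence_inl_of_ne ha _ hui]
      simp only [arcSum_dicycle]
      simp only [X, triVec_coalMap_right _ huv, cycDist_succ_self]
      simp only [triVec, ringVec_right _ huv, ringVec_succ_right huv, hβ]
      have e1 : t⁻¹ ^ (cycDist i u - 1) * t⁻¹ ^ (cycDist u i - 1) = t⁻¹ ^ (q - 2) := by
        have h1 := cycDist_add huv
        have h2 := cycDist_pos huv
        have h3 := cycDist_pos huv.symm
        rw [← pow_add]
        congr 1
        omega
      rw [e1, ← h.eq]
      ring
    · have hne : (Sum.inl i : CoalVertex (Fin q) a) ≠ Sum.inl v := by simpa using hv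
      rw [arcSum_coalescence_inl_of_ne hb _ hne, arcSum_coalescence_inl_of_ne hb _ hne,
        arcSum_coalescence_inl_of_ne ha _ hu, arcSum_coalescence_inl_of_ne ha _ hu]
      simp only [arcSum_dicycle, X, triVec]
      rw [ringVec_eq hu hv]
      linear_combination (-d * ringVec t⁻¹ u v (t⁻¹ ^ (cycDist u v - 1))
        (t - β - t⁻¹ ^ (p - 1)) (cycSucc i)) * hz
  · have hne : (Sum.inr w : CoalVertex (Fin q) a) ≠ Sum.inl v := by simp
    rw [arcSum_coalescence_inl_of_ne hb _ hne, arcSum_coalescence_inl_of_ne hb _ hne,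
      arcSum_coalescence_inr, arcSum_coalescence_inr]
    simp only [arcSum_dicycle]
    simp only [X, triVec_coalMap_left]
    simp only [triVec]
    rw [cycDist_succ w.2, pow_succ]
    linear_combination (-d * t⁻¹ ^ cycDist (cycSucc w.1) a * t⁻¹ ^ (cycDist u v - 1)) * hz
  · rw [arcSum_coalescence_inr, arcSum_coalescence_inr]
    simp only [arcSum_dicycle]
    simp only [X, triVec_coalMap_right _ huv]
    simp only [triVec]
    rw [cycDist_succ w.2, pow_succ]
    linear_combination (-d * t⁻¹ ^ cycDist (cycSucc w.1) b * (t - β - t⁻¹ ^ (p - 1))) * hz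

/-- The eigenvector of the tri-ring digraph is transported to `G` along the isomorphism. -/
theorem IsPerronRoot.radius_eq {V : Type*} [Fintype V] {G : Digraph V} {t c d : ℝ}
    (h : IsPerronRoot (c / d) p q s t) (hp : 2 ≤ p) (hs : 2 ≤ s) (huv : u ≠ v) (hc : 0 ≤ c)
    (hd : 0 < d) (hG : Isomorphic G (triRing p q s u v a b)) :
    degAdjRadius c d G = ENNReal.ofReal (c + d * t) := by
  obtain ⟨e⟩ := hG
  have ht := h.one_lt
  have hz : 0 < t⁻¹ := inv_pos.2 (by linarith)
  have : Nonempty V := ⟨e.symm (Sum.inl (Sum.inl u))⟩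
  have hx : 0 < t⁻¹ ^ (cycDist u v - 1) := pow_pos hz _
  have hpos : ∀ k, 0 < triVec t⁻¹ u v a b (t⁻¹ ^ (cycDist u v - 1))
      (t - c / d - t⁻¹ ^ (p - 1)) k := by
    rintro ((i | w) | w)
    · simp only [triVec, ringVec]
      split_ifs
      · exact mul_pos (pow_pos hz _) hx
      · exact mul_pos (pow_pos hz _) h.pos_left
    · exact mul_pos (pow_pos hz _) hx
    · exact mul_pos (pow_pos hz _) h.pos_left
  refine degAdjRadius_eq_of_pos_eigenvector G hc hd.le (by nlinarith)
    (fun v => hpos (e v)) fun k => ?_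
  have h1 := arcSum_of_iso e (fun _ => 1) k
  rw [arcSum_of_iso e, h1]
  exact h.triRing_eigen hp hs huv (by field_simp) (e k)

/-- Rotating the three cycles brings all identified vertices to their standard positions; on a
cycle of length two, moving `u` to `0` moves `v` to `1`. -/
theorem isomorphic_infTwoTwo (hs : 2 ≤ s) {u v : Fin 2} (huv : u ≠ v)
    {a : Fin 2} {b : Fin s} :
    Isomorphic (triRing 2 2 s u v a b) (infTwoTwo s (by omega)) := by
  obtain ⟨e₁, h₁⟩ := exists_dicycle_iso u 0
  obtain ⟨e₂, h₂⟩ := exists_dicycle_iso a 0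
  obtain ⟨e₃, h₃⟩ := exists_dicycle_iso b ⟨0, by omega⟩
  have hv : e₁ v = 1 := by
    have : e₁ v ≠ 0 := fun h => huv (e₁.injective (h₁.trans h.symm))
    omega
  obtain ⟨g, hg⟩ := isomorphic_coalescence e₁ e₂ h₁ h₂ (dicycle_no_loop le_rfl a)
  obtain ⟨g', -⟩ := isomorphic_coalescence (v₀ := Sum.inl v) (v₀' := Sum.inl 1) g e₃
    (by rw [hg, hv]) h₃ (dicycle_no_loop hs b)
  exact ⟨g'⟩

end TriRing

theorem Isomorphic.refl {V : Type*} (G : Digraph V) : Isomorphic G G := ⟨RelIso.refl _⟩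

theorem Isomorphic.trans {V W U : Type*} {G : Digraph V} {H : Digraph W} {K : Digraph U}
    (h : Isomorphic G H) (h' : Isomorphic H K) : Isomorphic G K := by
  obtain ⟨e⟩ := h
  obtain ⟨f⟩ := h'
  exact ⟨e.trans f⟩

/-- The size and the order of a tri-ring digraph determine each other. -/
theorem IsTriRing.size_eq_card_add_two {V : Type*} [Fintype V] {G : Digraph V}
    (hG : IsTriRing G) : size G = Fintype.card V + 2 := by
  obtain ⟨p, q, s, u, v, a, b, hp, hps, huv, ⟨e⟩⟩ := hG
  rw [size_eq_of_iso e, size_triRing hp (by omega), Fintype.card_congr e.toEquiv,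
    card_triRing hp (by omega)]
  omega

/-- The extremal property for all the matrices `c D(G) + d A(G)` with `0 ≤ c` and `0 < d`, which
covers both `A_α(G)` and the signless Laplacian. -/
theorem IsTriRing.radius_le_infTwoTwo {V : Type*} [Fintype V] {G : Digraph V} {m : ℕ}
    (hm : 6 ≤ m) (hG : IsTriRing G) (hsize : size G = m) {c d : ℝ} (hc : 0 ≤ c) (hd : 0 < d) :
    degAdjRadius c d G ≤ degAdjRadius c d (infTwoTwo (m - 4) (by omega)) ∧
      (degAdjRadius c d G = degAdjRadius c d (infTwoTwo (m - 4) (by omega)) →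
        Isomorphic G (infTwoTwo (m - 4) (by omega))) := by
  obtain ⟨p, q, s, u, v, a, b, hp, hps, huv, hiso⟩ := hG
  have hβ : 0 ≤ c / d := by positivity
  have hq : 2 ≤ q := by
    have := u.2
    have := v.2
    rw [Ne, Fin.ext_iff] at huv
    omega
  have hpqs : p + q + s = m := by
    obtain ⟨e⟩ := hiso
    rw [← hsize, size_eq_of_iso e, size_triRing hp (by omega)]
  have hrefl : Isomorphic (infTwoTwo (m - 4) (by omega))
      (triRing 2 2 (m - 4) 0 1 0 ⟨0, by omega⟩) := Isomorphic.refl _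
  obtain ⟨t, ht⟩ := exists_isPerronRoot q hβ hps
  rw [ht.radius_eq hp (by omega) huv hc hd hiso]
  by_cases h22 : p = 2 ∧ q = 2
  · obtain ⟨rfl, rfl⟩ := h22
    obtain rfl : s = m - 4 := by omega
    rw [ht.radius_eq le_rfl (by omega) zero_ne_one hc hd hrefl]
    exact ⟨le_rfl, fun _ => hiso.trans (isomorphic_infTwoTwo (by omega) huv)⟩
  · -- The root for `(2, 2, m - 4)` is sought beyond the root `t` for `(p, q, s)`.
    obtain ⟨t', htt', ht'⟩ := exists_isPerronRoot_gt (q := 2) hβ ht.one_lt.le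
      (show 2 ≤ m - 4 by omega) (Or.inr (ht.extremal_lt hp hps hq hpqs h22))
    rw [ht'.radius_eq le_rfl (by omega) zero_ne_one hc hd hrefl]
    have hlt : ENNReal.ofReal (c + d * t) < ENNReal.ofReal (c + d * t') := by
      have := ht'.one_lt
      exact (ENNReal.ofReal_lt_ofReal_iff (by positivity)).2 (by nlinarith)
    exact ⟨hlt.le, fun h => absurd h hlt.ne⟩

end AlphaSpectral

theorem mainTheorem2 (m : ℕ) (hm : 6 ≤ m) :
    -- `Inf(2, 2, m - 4)` is a tri-ring digraph of size `m` and of order `m - 2`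
    (AlphaSpectral.IsTriRing (AlphaSpectral.infTwoTwo (m - 4) (by omega)) ∧
      AlphaSpectral.size (AlphaSpectral.infTwoTwo (m - 4) (by omega)) = m ∧
      Fintype.card (AlphaSpectral.CoalVertex (AlphaSpectral.CoalVertex (Fin 2) (0 : Fin 2))
        (⟨0, by omega⟩ : Fin (m - 4))) = m - 2) ∧
    -- it is the unique maximizer of the `α`-spectral radius among those of size `m`
    (∀ α : ℝ, 0 ≤ α → α < 1 →
      ∀ (V : Type u) [Fintype V] (G : Digraph V),
        AlphaSpectral.IsTriRing G → AlphaSpectral.size G = m →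
          AlphaSpectral.alphaRadius α G ≤
            AlphaSpectral.alphaRadius α (AlphaSpectral.infTwoTwo (m - 4) (by omega)) ∧
          (AlphaSpectral.alphaRadius α G =
              AlphaSpectral.alphaRadius α (AlphaSpectral.infTwoTwo (m - 4) (by omega)) →
            AlphaSpectral.Isomorphic G (AlphaSpectral.infTwoTwo (m - 4) (by omega)))) ∧
    -- and of the signless Laplacian spectral radius among those of size `m`
    (∀ (V : Type u) [Fintype V] (G : Digraph V),
        AlphaSpectral.IsTriRing G → AlphaSpectral.size G = m →
          AlphaSpectral.signlessRadius G ≤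
            AlphaSpectral.signlessRadius (AlphaSpectral.infTwoTwo (m - 4) (by omega)) ∧
          (AlphaSpectral.signlessRadius G =
              AlphaSpectral.signlessRadius (AlphaSpectral.infTwoTwo (m - 4) (by omega)) →
            AlphaSpectral.Isomorphic G (AlphaSpectral.infTwoTwo (m - 4) (by omega)))) ∧
    -- and of the signless Laplacian spectral radius among those of order `m - 2`
    (∀ (V : Type u) [Fintype V] (G : Digraph V),
        AlphaSpectral.IsTriRing G → Fintype.card V = m - 2 →
          AlphaSpectral.signlessRadius G ≤
            AlphaSpectral.signlessRadius (AlphaSpectral.infTwoTwo (m - 4) (by omega)) ∧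
          (AlphaSpectral.signlessRadius G =
              AlphaSpectral.signlessRadius (AlphaSpectral.infTwoTwo (m - 4) (by omega)) →
            AlphaSpectral.Isomorphic G (AlphaSpectral.infTwoTwo (m - 4) (by omega)))) := by
  refine ⟨⟨?_, ?_, ?_⟩, ?_, ?_, ?_⟩
  · exact ⟨2, 2, m - 4, 0, 1, 0, ⟨0, by omega⟩, le_rfl, by omega, zero_ne_one,
      AlphaSpectral.Isomorphic.refl _⟩
  · rw [AlphaSpectral.infTwoTwo, AlphaSpectral.size_triRing le_rfl (by omega)]
    omega
  · rw [AlphaSpectral.card_triRing le_rfl (by omega)]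
    omega
  · intro α hα0 hα1 V _ G hG hsize
    simp only [AlphaSpectral.alphaRadius_eq_degAdjRadius]
    exact hG.radius_le_infTwoTwo hm hsize hα0 (sub_pos.2 hα1)
  · intro V _ G hG hsize
    simp only [AlphaSpectral.signlessRadius_eq_degAdjRadius]
    exact hG.radius_le_infTwoTwo hm hsize zero_le_one one_pos
  · intro V _ G hG hcard
    simp only [AlphaSpectral.signlessRadius_eq_degAdjRadius]
    exact hG.radius_le_infTwoTwo hm (by have := hG.size_eq_card_add_two; omega) zero_le_one one_pos
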